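/- Let $a<b$, let $n\ge 1$ and $d\ge 1$ be integers, put $h=(b-a)/n$ and $x_i=a+ih$ for $0\le i\le n$, $x_i=a$ for $i<0$ and $x_i=b$ for $i>n$. Let $J=\{1,\dots,n+d\}$ and let $B_j$, $j\in J$, be the normalized B-spline of degree $d$ with knots $x_{j-d-1},\dots,x_j$ (at the point $b$ it is defined by continuity from the left). Let $\theta_j^{(r)}=\binom{d}{r}^{-1}\operatorname{symm}_r(x_{j-d},\dots,x_{j-1})$ for $0\le r\le d$, where $\operatorname{symm}_r$ is the $r$-th elementary symmetric function. Let $\Pi_d$ be the space of polynomials of degree at most $d$. If $d$ is even, the data set is $T_n=\{t_j: j\in J\}$ with $t_j=\frac12(x_{j-2}+x_{j-1})$; if $d$ is odd, it is $X_n=\{x_0,\dots,x_n\}$. For nodes $\tau_{j,1},\dots,\tau_{j,m_j}$ ($j\in J$), a discrete quasi-interpolant (dQI) of degree $d$ with these nodes is an operator $Q_d f=\sum_{j\in J}\mu_j(f)B_j$ with $\mu_j(f)=\sum_{i=1}^{m_j} w_{j,i}f(\tau_{j,i})$, $w_{j,i}\in\mathbb R$, with all nodes in the data set, and exact on $\Pi_d$,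 i.e. $Q_dp=p$ on $[a,b]$ for all $p\in\Pi_d$. (1) For arbitrary real nodes $\tau_{j,i}$ and coefficients $w_{j,i}$, the operator $Q_d$ is exact on $\Pi_d$ if and only if, for every $j\in J$, the coefficients of $\mu_j$ solve the linear system $$\sum_{i=1}^{m_j}\tau_{j,i}^{\,r}\,w_{j,i}=\theta_j^{(r)},\qquad 0\le r\le d. \tag{$*$}$$ (2) Suppose that for every $j\in J$ exactly $d+1$ distinct nodes of the data set are prescribed. Then for every $j$ the determinant of $(*)$ is the Vandermonde determinant $\prod_{i<k}(\tau_{j,k}-\tau_{j,i})\neq0$, and $(*)$ has exactly one solution; consequently there is exactly one choice of the coefficients for which $Q_d$ is exact on $\Pi_d$, and exactly one dQI of degree $d$ with these nodes. (3) Suppose $n\ge d$ and take the following standard nodes. If $d$ is even: $\mu_1$ has the node $t_1=a$ and $\mu_{n+d}$ the node $t_{n+2}=b$; $\mu_j$ has the nodes $t_1,\dots,t_{d+1}$ for $2\le j\le d$, the nodes $t_{j-d+1},\dots,t_{j+1}$ for $d+1\le j\le n$, and the nodes $t_{n+2-d},\dots,t_{n+2}$ for $n+1\le j\le n+d-1$.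 If $d$ is odd: $\mu_1$ has the node $x_0=a$ and $\mu_{n+d}$ the node $x_n=b$; for the remaining $j$, $\mu_j$ has the nodes $x_0,\dots,x_d$ if $2\le j\le d-1$, the $d$ nodes $x_{j-d},\dots,x_{j-1}$ if $d\le j\le n+1$, and the nodes $x_{n-d},\dots,x_n$ if $n+2\le j\le n+d-1$. Then for every $j$ the $m_j\le d+1$ nodes are distinct, the determinant of the first $m_j$ equations of $(*)$ is the Vandermonde determinant $\prod_{i<k}(\tau_{j,k}-\tau_{j,i})\ne0$, and the full system $(*)$ has exactly one solution; consequently there is exactly one choice of the coefficients for which $Q_d$ is exact on $\Pi_d$, and exactly one dQI of degree $d$ with these nodes. -/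

import Mathlib

open Polynomial

noncomputable section

namespace DQI

/-- The knots `x_i` of the uniform partition of `[a, b]` into `n` intervals, extended to all
integers by `x_i = a` for `i ≤ 0` and `x_i = b` for `i ≥ n` (multiple knots at the endpoints). -/
def knot (a b : ℝ) (n : ℕ) (i : ℤ) : ℝ :=
  a + ((max 0 (min i n) : ℤ) : ℝ) * ((b - a) / n)

/-- Cox-de Boor recursion: the normalized B-spline of degree `k` with knots
`x_i, x_{i+1}, ..., x_{i+k+1}`. A term with a vanishing denominator is zero. In degree `0` the
intervals are closed on the left and open on the right, except that the last nonempty one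
contains the right endpoint `b`. -/
def bsplineAux (x : ℤ → ℝ) (b : ℝ) : ℕ → ℤ → ℝ → ℝ
  | 0, i, u =>
      open Classical in
      if (x i ≤ u ∧ u < x (i + 1)) ∨ (x i < u ∧ u = x (i + 1) ∧ u = b) then 1 else 0
  | k + 1, i, u =>
      (u - x i) / (x (i + k + 1) - x i) * bsplineAux x b k i u
        + (x (i + k + 2) - u) / (x (i + k + 2) - x (i + 1)) * bsplineAux x b k (i + 1) u

/-- The B-spline `B_j` of degree `d`, with support `[x_{j-d-1}, x_j]`, for `1 ≤ j ≤ n + d`. -/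
def bspline (a b : ℝ) (n d : ℕ) (j : ℤ) (u : ℝ) : ℝ :=
  bsplineAux (knot a b n) b d (j - d - 1) u

/-- `θ_j^{(r)} = (d choose r)⁻¹ symm_r (x_{j-d}, ..., x_{j-1})`, knots counted with their
multiplicities. -/
def theta (a b : ℝ) (n d : ℕ) (j : ℤ) (r : ℕ) : ℝ :=
  ((d.choose r : ℕ) : ℝ)⁻¹ *
    ((Multiset.range d).map fun l : ℕ => knot a b n (j - d + l)).esymm r

/-- The data sites: the points `t_i = (x_{i-2} + x_{i-1}) / 2` if `d` is even, and the
knots `x_i` if `d` is odd. -/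
def site (a b : ℝ) (n d : ℕ) (i : ℤ) : ℝ :=
  if Even d then (knot a b n (i - 2) + knot a b n (i - 1)) / 2 else knot a b n i

/-- The set `T_n = {t_i : 1 ≤ i ≤ n + d}` for even `d`, and `X_n = {x_i : 0 ≤ i ≤ n}` for
odd `d`. -/
def siteSet (a b : ℝ) (n d : ℕ) : Set ℝ :=
  if Even d then site a b n d '' Set.Icc 1 ((n : ℤ) + d) else site a b n d '' Set.Icc 0 (n : ℤ)

/-- The index `j ∈ {1, ..., n + d}` belonging to an element of `Fin (n + d)`. -/
def idx {N : ℕ} (j : Fin N) : ℤ := (j : ℤ) + 1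

/-- The operator `f ↦ ∑_j μ_j(f) B_j` with `μ_j(f) = ∑_i w_{j,i} f(τ_{j,i})`. -/
def operator (a b : ℝ) (n d : ℕ) {m : Fin (n + d) → ℕ} (τ w : ∀ j, Fin (m j) → ℝ)
    (f : ℝ → ℝ) (u : ℝ) : ℝ :=
  ∑ j : Fin (n + d), (∑ i, w j i * f (τ j i)) * bspline a b n d (idx j) u

/-- `Q p = p` on `[a, b]` for every polynomial `p` of degree at most `d`. -/
def ExactOn (a b : ℝ) (d : ℕ) (Q : (ℝ → ℝ) → ℝ → ℝ) : Prop :=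
  ∀ p ∈ degreeLE ℝ (d : WithBot ℕ), ∀ u ∈ Set.Icc a b, Q (fun v => p.eval v) u = p.eval u

/-- `Q` is a discrete quasi-interpolant of degree `d` whose `j`-th coefficient functional is a
linear combination of the values at the points `τ_{j,i}` of the set `T_n` or `X_n`. -/
def IsDQI (a b : ℝ) (n d : ℕ) {m : Fin (n + d) → ℕ} (τ : ∀ j, Fin (m j) → ℝ)
    (Q : (ℝ → ℝ) → ℝ → ℝ) : Prop :=
  (∀ j i, τ j i ∈ siteSet a b n d) ∧
    (∃ w : ∀ j, Fin (m j) → ℝ, Q = operator a b n d τ w) ∧ ExactOn a b d Q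

/-- The matrix `(τ_i ^ r)`, with rows `0 ≤ r ≤ d`, of the linear system for the coefficients of
a functional with nodes `τ_i`. -/
def systemMatrix (d : ℕ) {m : ℕ} (τ : Fin m → ℝ) : Matrix (Fin (d + 1)) (Fin m) ℝ :=
  Matrix.of fun r i => τ i ^ (r : ℕ)

/-- The right-hand side `(θ_j^{(r)})`, `0 ≤ r ≤ d`, of the system of the functional `μ_j`. -/
def systemRhs (a b : ℝ) (n d : ℕ) (j : Fin (n + d)) : Fin (d + 1) → ℝ :=
  fun r => theta a b n d (idx j) r

/-- The number of nodes of the functional `μ_j` in the standard choice of nodes. -/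
def stdCard (n d : ℕ) (j : ℤ) : ℕ :=
  if j = 1 ∨ j = n + d then 1
  else if Odd d ∧ (d : ℤ) ≤ j ∧ j ≤ n + 1 then d
  else d + 1

/-- The index of the first node of the functional `μ_j` in the standard choice of nodes. The
nodes of `μ_j` are consecutive sites: the endpoint for `j = 1` and `j = n + d`, the first
(last) `d + 1` sites for the other boundary B-splines, and for interior B-splines the
`d + 1` sites (`d` even) or the `d` sites (`d` odd) centred at the middle of the support. -/
def stdFirst (n d : ℕ) (j : ℤ) : ℤ :=
  if Even d then
    if j ≤ d then 1
    else if j ≤ n then j - d + 1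
    else if j < n + d then n + 2 - d
    else n + 2
  else
    if j < d then 0
    else if j ≤ n + 1 then j - d
    else if j < n + d then n - d
    else n

/-- The standard choice of nodes of `μ_j`. -/
def stdNodes (a b : ℝ) (n d : ℕ) (j : Fin (n + d)) (i : Fin (stdCard n d (idx j))) : ℝ :=
  site a b n d (stdFirst n d (idx j) + (i : ℕ))

end DQI

end

/-! Marsden's identity shows that `theta` holds the B-spline coefficients of the monomials: on [a,
b], u^r is the sum of the θ_j^{(r)} B_j(u) (`sum_theta_mul_bspline`). Applied to X^r, the operator
has the coefficients ∑_i w_{j,i} τ_{j,i}^r instead. Since the B-splines are linearly independent on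
[a, b] (`eq_zero_of_sum_mul_bspline`), exactness decouples into one moment system for each j
(`exactOn_operator_iff`).

Distinct nodes make the first m_j equations a transposed Vandermonde system. Hence there is at most
one solution, and there is one if m_j = d + 1. The shorter standard systems are overdetermined but
consistent. For the first and last functional all d knots entering `theta` coincide with the single
node, so the right-hand side consists of its powers. For odd d and interior nodes, the nodes are
exactly the knots entering `theta`; the blossom of the monic polynomial vanishing there is zero at
these knots, which makes the last equation a consequence of the others
(`existsUnique_mulVec_of_odd`). -/

namespace DQI

open Finset

/-! ### B-splines on a single knot interval: Marsden's identity and local independence. -/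

section Local

variable {x : ℤ → ℝ} {b u : ℝ} {m : ℤ}

/-- The knot interval of index `m` is the one that contains `u`. -/
structure IsActive (x : ℤ → ℝ) (b u : ℝ) (m : ℤ) : Prop where
  lt : x m < x (m + 1)
  zero : ∀ i, bsplineAux x b 0 i u = if i = m then 1 else 0

/-- The second alternative is the convention of left continuity at `b`: no knot exceeds `b`, so only
the nonempty interval ending at `b` contains this point. -/
theorem isActive_of_mem (hx : Monotone x) (hb : ∀ i, x i ≤ b) (hm : x m < x (m + 1))
    (hu : (x m ≤ u ∧ u < x (m + 1)) ∨ (u = x (m + 1) ∧ u = b)) : IsActive x b u m := by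
  refine ⟨hm, fun i => ?_⟩
  have hmb := hb (m + 1)
  have hib := hb (i + 1)
  rw [bsplineAux]
  rcases lt_trichotomy i m with h | h | h
  · have h1 : x (i + 1) ≤ x m := hx (by omega)
    rw [if_neg, if_neg h.ne]
    rintro (⟨h2, h3⟩ | ⟨h2, h3, h4⟩) <;> rcases hu with ⟨h5, h6⟩ | ⟨h5, h6⟩ <;> linarith
  · subst h
    rw [if_pos, if_pos rfl]
    rcases hu with h5 | ⟨h5, h6⟩
    · exact Or.inl h5
    · exact Or.inr ⟨by linarith, h5, h6⟩
  · have h1 : x (m + 1) ≤ x i := hx (by omega)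
    rw [if_neg, if_neg h.ne']
    rintro (⟨h2, h3⟩ | ⟨h2, h3, h4⟩) <;> rcases hu with ⟨h5, h6⟩ | ⟨h5, h6⟩ <;> linarith

theorem bsplineAux_eq_zero (h : IsActive x b u m) :
    ∀ (k : ℕ) (i : ℤ), i < m - k ∨ m < i → bsplineAux x b k i u = 0
  | 0, i, hi => by
      rw [h.zero, if_neg]
      push_cast at hi
      omega
  | k + 1, i, hi => by
      push_cast at hi
      rw [bsplineAux, bsplineAux_eq_zero h k i (by omega),
        bsplineAux_eq_zero h k (i + 1) (by omega), mul_zero, mul_zero, add_zero]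

/-- The polynomial `∏ (X + x_l)` over the interior knots of the B-spline of degree `k` whose
first knot is `x_i`. -/
noncomputable def dualPoly (x : ℤ → ℝ) (k : ℕ) (i : ℤ) : ℝ[X] :=
  ∏ l ∈ range k, (X + C (x (i + 1 + l)))

theorem dualPoly_succ (k : ℕ) (i : ℤ) :
    dualPoly x (k + 1) i = dualPoly x k i * (X + C (x (i + k + 1))) := by
  rw [dualPoly, prod_range_succ, dualPoly, show i + 1 + (k : ℤ) = i + k + 1 by ring]

theorem dualPoly_succ_pred (k : ℕ) (i : ℤ) :
    dualPoly x (k + 1) (i - 1) = dualPoly x k i * (X + C (x i)) := by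
  rw [dualPoly, prod_range_succ', dualPoly]
  congr 1
  · refine prod_congr rfl fun l _ => ?_
    congr 3
    push_cast
    ring
  · congr 3
    push_cast
    ring

/-- The two products differ from `dualPoly x k i` by the factors X + x_{i+k+1} and X + x_i. The
Cox-de Boor weights write u as an affine combination of these two knots, so the weighted factors add
up to X + u. -/
theorem C_mul_dualPoly_step (hx : Monotone x) (h : IsActive x b u m) (k : ℕ) {i : ℤ}
    (hi : m - k ≤ i) (hi' : i ≤ m) (N : ℝ) :
    C ((u - x i) / (x (i + k + 1) - x i) * N) * dualPoly x (k + 1) i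
      + C ((x (i + k + 1) - u) / (x (i + k + 1) - x i) * N) * dualPoly x (k + 1) (i - 1)
      = (X + C u) * (C N * dualPoly x k i) := by
  have h1 : x i ≤ x m := hx hi'
  have h2 : x (m + 1) ≤ x (i + k + 1) := hx (by omega)
  -- The support contains the active interval, so the convention for vanishing denominators plays no
  -- role here.
  have h3 : x (i + k + 1) - x i ≠ 0 := by linarith [h.lt]
  rw [dualPoly_succ, dualPoly_succ_pred]
  have e1 : (u - x i) / (x (i + k + 1) - x i) + (x (i + k + 1) - u) / (x (i + k + 1) - x i)
      = 1 := by
    field_simp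
    ring
  have e2 : (u - x i) / (x (i + k + 1) - x i) * x (i + k + 1)
      + (x (i + k + 1) - u) / (x (i + k + 1) - x i) * x i = u := by
    field_simp
    ring
  generalize (u - x i) / (x (i + k + 1) - x i) = p at *
  generalize (x (i + k + 1) - u) / (x (i + k + 1) - x i) = q at *
  have e1' := congrArg (C : ℝ → ℝ[X]) e1
  have e2' := congrArg (C : ℝ → ℝ[X]) e2
  simp only [C_add, C_mul, C_1] at e1' e2' ⊢
  linear_combination (C N * dualPoly x k i * X) * e1' + (C N * dualPoly x k i) * e2'

/-- Marsden's identity on one knot interval. -/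
theorem marsden (hx : Monotone x) (h : IsActive x b u m) (k : ℕ) :
    ∑ s ∈ range (k + 1), C (bsplineAux x b k (m - k + s) u) * dualPoly x k (m - k + s)
      = (X + C u) ^ k := by
  induction k with
  | zero => simp [dualPoly, h.zero]
  | succ k ih =>
    have e : ∀ s : ℕ, m - ((k + 1 : ℕ) : ℤ) + ((s + 1 : ℕ) : ℤ) = m - k + s := fun s => by
      push_cast
      ring
    have e' : ∀ s : ℕ, m - ((k + 1 : ℕ) : ℤ) + s = m - k + s - 1 := fun s => by
      push_cast
      ring
    simp only [bsplineAux, C_add, add_mul, sum_add_distrib]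
    -- Each degree `k` B-spline occurs in two neighbours of degree `k + 1`. The terms split off have
    -- indices m - k - 1 and m + 1, outside the active range; the rest pair up by index.
    rw [sum_range_succ', sum_range_succ (n := k + 1)]
    rw [bsplineAux_eq_zero h k _ (Or.inl (by push_cast; omega)),
      bsplineAux_eq_zero h k (m - ((k + 1 : ℕ) : ℤ) + ((k + 1 : ℕ) : ℤ) + 1)
        (Or.inr (by push_cast; omega))]
    simp only [mul_zero, C_0, zero_mul, add_zero, e, e']
    rw [← sum_add_distrib, pow_succ', ← ih, mul_sum]
    refine sum_congr rfl fun s hs => ?_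
    rw [mem_range] at hs
    rw [← C_mul_dualPoly_step hx h k (i := m - k + s) (by omega) (by omega),
      show m - (k : ℤ) + s - 1 + k + 2 = m - k + s + k + 1 by ring,
      show m - (k : ℤ) + s - 1 + 1 = m - k + s by ring]

theorem coeff_dualPoly {k r : ℕ} (hr : r ≤ k) (i : ℤ) :
    (dualPoly x k i).coeff (k - r)
      = ((Multiset.range k).map fun l : ℕ => x (i + 1 + l)).esymm r := by
  have h1 : dualPoly x k i
      = (((Multiset.range k).map fun l : ℕ => x (i + 1 + l)).map fun t => X + C t).prod := by
    rw [Multiset.map_map]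
    rfl
  rw [h1, Multiset.prod_X_add_C_coeff _ (by simp)]
  congr 1
  simp only [Multiset.card_map, Multiset.card_range]
  omega

/-- The monomials as linear combinations of the B-splines on one knot interval. -/
theorem pow_eq_sum_bsplineAux (hx : Monotone x) (h : IsActive x b u m) {k r : ℕ} (hr : r ≤ k) :
    ∑ s ∈ range (k + 1), ((k.choose r : ℕ) : ℝ)⁻¹ *
        ((Multiset.range k).map fun l : ℕ => x (m - k + s + 1 + l)).esymm r
          * bsplineAux x b k (m - k + s) u = u ^ r := by
  have h1 := congrArg (fun p => p.coeff (k - r)) (marsden hx h k)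
  simp only [finsetSum_coeff, coeff_C_mul, coeff_dualPoly hr, coeff_X_add_C_pow] at h1
  rw [Nat.choose_symm hr, Nat.sub_sub_self hr] at h1
  have hc : ((k.choose r : ℕ) : ℝ) ≠ 0 := by exact_mod_cast (Nat.choose_pos hr).ne'
  simp only [mul_assoc]
  rw [← mul_sum, inv_mul_eq_iff_eq_mul₀ hc, mul_comm, ← h1]
  exact sum_congr rfl fun s _ => mul_comm _ _

theorem linearIndependent_pow_on {S : Set ℝ} (hS : S.Infinite) (k : ℕ) :
    LinearIndependent ℝ (fun (r : Fin k) (u : S) => (u : ℝ) ^ (r : ℕ)) := by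
  rw [Fintype.linearIndependent_iff]
  intro g hg
  have hp : (∑ r : Fin k, C (g r) * X ^ (r : ℕ) : ℝ[X]) = 0 := by
    refine eq_zero_of_infinite_isRoot _ (hS.mono fun u hu => ?_)
    have := congrFun hg ⟨u, hu⟩
    simpa [eval_finsetSum, IsRoot.def] using this
  intro r
  have := congrArg (fun p => p.coeff (r : ℕ)) hp
  simpa [finsetSum_coeff, coeff_C_mul, coeff_X_pow, Fin.val_inj] using this

/-- The B-splines that do not vanish on a knot interval are linearly independent there. -/
theorem linearIndependent_bsplineAux (hx : Monotone x) (hb : ∀ i, x i ≤ b)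
    (hm : x m < x (m + 1)) (k : ℕ) :
    LinearIndependent ℝ (fun (s : Fin (k + 1)) (u : Set.Ioo (x m) (x (m + 1))) =>
      bsplineAux x b k (m - k + (s : ℕ)) u) := by
  -- Dimension count: the span of these k + 1 functions contains the k + 1 independent monomials.
  rw [linearIndependent_iff_card_le_finrank_span, Set.finrank]
  have hV := linearIndependent_pow_on (Set.Ioo_infinite hm) (k + 1)
  rw [← finrank_span_eq_card hV]
  have := FiniteDimensional.span_of_finite ℝ (Set.finite_range fun (s : Fin (k + 1))
    (u : Set.Ioo (x m) (x (m + 1))) => bsplineAux x b k (m - k + (s : ℕ)) u)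
  refine Submodule.finrank_mono (Submodule.span_le.2 ?_)
  rintro _ ⟨r, rfl⟩
  have : (fun u : Set.Ioo (x m) (x (m + 1)) => (u : ℝ) ^ (r : ℕ)) = ∑ s : Fin (k + 1),
      (((k.choose r : ℕ) : ℝ)⁻¹ *
        ((Multiset.range k).map fun l : ℕ => x (m - k + (s : ℕ) + 1 + l)).esymm r) •
          fun u : Set.Ioo (x m) (x (m + 1)) => bsplineAux x b k (m - k + (s : ℕ)) u := by
    ext u
    rw [← pow_eq_sum_bsplineAux hx
      (isActive_of_mem hx hb hm (Or.inl ⟨u.2.1.le, u.2.2⟩)) (Nat.lt_succ_iff.1 r.2),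
      Finset.sum_apply, ← Fin.sum_univ_eq_sum_range (fun s : ℕ => ((k.choose r : ℕ) : ℝ)⁻¹ *
        ((Multiset.range k).map fun l : ℕ => x (m - k + s + 1 + l)).esymm r
          * bsplineAux x b k (m - k + s) u)]
    rfl
  simp only [SetLike.mem_coe]
  rw [this]
  exact Submodule.sum_mem _ fun s _ => Submodule.smul_mem _ _ (Submodule.subset_span ⟨s, rfl⟩)

end Local

/-! ### The uniform knots, global B-spline expansions, and the exactness criterion. -/

section Knots

variable {a b : ℝ} {n d : ℕ}

theorem knot_monotone (hab : a < b) : Monotone (knot a b n) := fun i j hij => by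
  have h : (max 0 (min i (n : ℤ)) : ℤ) ≤ max 0 (min j (n : ℤ)) :=
    max_le_max le_rfl (min_le_min hij le_rfl)
  have h' : (((max 0 (min i (n : ℤ)) : ℤ)) : ℝ) ≤ ((max 0 (min j (n : ℤ)) : ℤ) : ℝ) := by
    exact_mod_cast h
  exact add_le_add_right
    (mul_le_mul_of_nonneg_right h' (div_nonneg (by linarith) n.cast_nonneg)) a

theorem knot_of_nonpos {i : ℤ} (hi : i ≤ 0) : knot a b n i = a := by
  rw [knot, max_eq_left ((min_le_left _ _).trans hi), Int.cast_zero, zero_mul, add_zero]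

theorem knot_of_mem {i : ℤ} (hi : 0 ≤ i) (hi' : i ≤ n) :
    knot a b n i = a + i * ((b - a) / n) := by
  rw [knot, min_eq_left hi', max_eq_right hi]

theorem knot_of_ge (hn : 1 ≤ n) {i : ℤ} (hi : n ≤ i) : knot a b n i = b := by
  have : (n : ℝ) ≠ 0 := by positivity
  rw [knot, min_eq_right hi, max_eq_right (by positivity), Int.cast_natCast]
  field_simp
  ring

theorem knot_le (hab : a < b) (hn : 1 ≤ n) (i : ℤ) : knot a b n i ≤ b := by
  exact (knot_monotone hab (le_max_right (n : ℤ) i)).trans_eq (knot_of_ge hn (le_max_left _ _))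

theorem knot_ge (hab : a < b) (i : ℤ) : a ≤ knot a b n i := by
  exact (knot_of_nonpos (min_le_left 0 i)).symm.trans_le (knot_monotone hab (min_le_right _ _))

theorem knot_lt (hab : a < b) (hn : 1 ≤ n) {i j : ℤ} (hij : i < j) (hj : 0 < j) (hi : i < n) :
    knot a b n i < knot a b n j := by
  have h : max 0 (min i (n : ℤ)) < max 0 (min j (n : ℤ)) := by omega
  have h' : (((max 0 (min i (n : ℤ)) : ℤ)) : ℝ) < ((max 0 (min j (n : ℤ)) : ℤ) : ℝ) := by
    exact_mod_cast h
  have hn' : (0 : ℝ) < n := by exact_mod_cast hn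
  exact add_lt_add_right (mul_lt_mul_of_pos_right h' (div_pos (by linarith) hn')) a

theorem exists_isActive (hab : a < b) (hn : 1 ≤ n) {u : ℝ} (hu : u ∈ Set.Icc a b) :
    ∃ m : ℕ, m < n ∧ IsActive (knot a b n) b u m := by
  have hn' : (0 : ℝ) < n := by exact_mod_cast hn
  rcases hu.2.eq_or_lt with rfl | hub
  · refine ⟨n - 1, by omega, isActive_of_mem (knot_monotone hab) (knot_le hab hn)
      (knot_lt hab hn (by omega) (by omega) (by omega)) (Or.inr ⟨?_, rfl⟩)⟩
    rw [knot_of_ge hn (by omega)]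
  · have hh : 0 < (b - a) / n := div_pos (by linarith) hn'
    have h0 : 0 ≤ (u - a) / ((b - a) / n) := div_nonneg (by linarith [hu.1]) hh.le
    have h1 : (u - a) / ((b - a) / n) < n := by
      rw [div_lt_iff₀ hh, mul_div_cancel₀ _ hn'.ne']
      linarith
    have hm : ⌊(u - a) / ((b - a) / n)⌋₊ < n := (Nat.floor_lt h0).2 h1
    refine ⟨_, hm, isActive_of_mem (knot_monotone hab) (knot_le hab hn)
      (knot_lt hab hn (by omega) (by omega) (by omega)) (Or.inl ?_)⟩
    rw [knot_of_mem (by omega) (by omega), knot_of_mem (by omega) (by omega)]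
    have h2 := Nat.floor_le h0
    have h3 := Nat.lt_floor_add_one ((u - a) / ((b - a) / n))
    rw [le_div_iff₀ hh] at h2
    rw [div_lt_iff₀ hh] at h3
    push_cast
    constructor <;> linarith

/-- Only the zero-based indices m, ..., m + d are active on interval `m`, and m < n keeps them all
below n + d. -/
theorem sum_mul_bspline {u : ℝ} {m : ℕ} (hm : m < n) (h : IsActive (knot a b n) b u m)
    (c : ℕ → ℝ) :
    ∑ j : Fin (n + d), c j * bspline a b n d (idx j) u
      = ∑ s ∈ range (d + 1), c (m + s) * bsplineAux (knot a b n) b d (m - d + s) u := by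
  have e : ∀ j : ℕ, bspline a b n d ((j : ℤ) + 1) u
      = bsplineAux (knot a b n) b d (j - d) u := fun j => by
    rw [bspline, show (j : ℤ) + 1 - d - 1 = j - d by ring]
  simp only [idx, e]
  rw [Fin.sum_univ_eq_sum_range
    (fun j : ℕ => c j * bsplineAux (knot a b n) b d ((j : ℤ) - d) u) (n + d)]
  rw [← sum_subset (s₁ := Ico m (m + (d + 1)))]
  · rw [sum_Ico_eq_sum_range, Nat.add_sub_cancel_left]
    refine sum_congr rfl fun s _ => ?_
    rw [show ((m + s : ℕ) : ℤ) - d = m - d + s by push_cast; ring]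
  · intro j hj
    rw [mem_Ico] at hj
    rw [mem_range]
    omega
  · intro j _ hj
    rw [mem_Ico] at hj
    rw [bsplineAux_eq_zero h d _ (by omega), mul_zero]

theorem sum_theta_mul_bspline (hab : a < b) (hn : 1 ≤ n) {r : ℕ} (hr : r ≤ d) {u : ℝ}
    (hu : u ∈ Set.Icc a b) :
    ∑ j : Fin (n + d), theta a b n d (idx j) r * bspline a b n d (idx j) u = u ^ r := by
  obtain ⟨m, hm, h⟩ := exists_isActive hab hn hu
  have := sum_mul_bspline (d := d) hm h fun j : ℕ => theta a b n d ((j : ℤ) + 1) r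
  rw [← pow_eq_sum_bsplineAux (knot_monotone hab) h hr]
  refine this.trans (sum_congr rfl fun s _ => ?_)
  rw [theta, show ((m + s : ℕ) : ℤ) + 1 - d = m - d + s + 1 by push_cast; ring]

/-- The B-splines are linearly independent on `[a, b]`. -/
theorem eq_zero_of_sum_mul_bspline (hab : a < b) (hn : 1 ≤ n) {c : Fin (n + d) → ℝ}
    (hc : ∀ u ∈ Set.Icc a b, ∑ j, c j * bspline a b n d (idx j) u = 0) (j : Fin (n + d)) :
    c j = 0 := by
  -- A nonempty knot interval inside the support of the B-spline: m ≤ j ≤ m + d because j < n + d.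
  set m : ℕ := min j (n - 1) with hmdef
  have hm : m < n := by omega
  have hlt : knot a b n m < knot a b n (m + 1) := knot_lt hab hn (by omega) (by omega) (by omega)
  set c' : ℕ → ℝ := fun k => if hk : k < n + d then c ⟨k, hk⟩ else 0 with hc'
  have hcc : ∀ j : Fin (n + d), c j = c' j := fun j => by simp [hc']
  have hli := linearIndependent_bsplineAux (knot_monotone hab) (knot_le hab hn) hlt d
  rw [Fintype.linearIndependent_iff] at hli
  have hz := hli (fun s => c' (m + s)) ?_ ⟨(j : ℕ) - m, by omega⟩
  · rw [hcc, ← hz]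
    congr 1
    simp only
    omega
  · ext ⟨u, hu⟩
    have hu' : u ∈ Set.Icc a b :=
      ⟨(knot_ge hab _).trans hu.1.le, hu.2.le.trans (knot_le hab hn _)⟩
    have hs := hc u hu'
    simp only [hcc] at hs
    rw [sum_mul_bspline hm (isActive_of_mem (knot_monotone hab) (knot_le hab hn) hlt
      (Or.inl ⟨hu.1.le, hu.2⟩))] at hs
    rw [Finset.sum_apply, Pi.zero_apply, ← hs, ← Fin.sum_univ_eq_sum_range
      (fun s : ℕ => c' (m + s) * bsplineAux (knot a b n) b d (m - d + s) u)]
    rfl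

/-- Exactness in terms of the linear systems of the coefficient functionals. -/
theorem exactOn_operator_iff (hab : a < b) (hn : 1 ≤ n) {m : Fin (n + d) → ℕ}
    (τ w : ∀ j, Fin (m j) → ℝ) :
    ExactOn a b d (operator a b n d τ w) ↔
      ∀ j, (systemMatrix d (τ j)).mulVec (w j) = systemRhs a b n d j := by
  have hmv : ∀ j (r : Fin (d + 1)),
      (systemMatrix d (τ j)).mulVec (w j) r = ∑ i, w j i * τ j i ^ (r : ℕ) := fun j r => by
    simp only [systemMatrix, Matrix.mulVec, dotProduct, Matrix.of_apply, mul_comm]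
  constructor
  · intro h j
    ext r
    rw [hmv, systemRhs, ← sub_eq_zero]
    refine eq_zero_of_sum_mul_bspline (c := fun j =>
      ∑ i, w j i * τ j i ^ (r : ℕ) - theta a b n d (idx j) r) hab hn (fun u hu => ?_) j
    simp only [sub_mul, sum_sub_distrib]
    rw [sum_theta_mul_bspline hab hn (Nat.lt_succ_iff.1 r.2) hu, sub_eq_zero]
    have := h (X ^ (r : ℕ)) (mem_degreeLE.2 ((degree_X_pow_le _).trans
      (by exact_mod_cast Nat.lt_succ_iff.1 r.2))) u hu
    simpa only [operator, eval_pow, eval_X] using this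
  · intro h p hp u hu
    have hp' : p.natDegree < d + 1 :=
      Nat.lt_succ_iff.2 (natDegree_le_iff_degree_le.2 (mem_degreeLE.1 hp))
    have he : ∀ v, p.eval v = ∑ r : Fin (d + 1), p.coeff r * v ^ (r : ℕ) := fun v => by
      rw [eval_eq_sum_range' hp', Fin.sum_univ_eq_sum_range (fun r => p.coeff r * v ^ r)]
    have hj : ∀ j, ∑ i, w j i * p.eval (τ j i)
        = ∑ r : Fin (d + 1), p.coeff r * theta a b n d (idx j) r := fun j => by
      simp only [he, mul_sum]
      rw [sum_comm]
      refine sum_congr rfl fun r _ => ?_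
      have := congrFun (h j) r
      rw [hmv, systemRhs] at this
      rw [← this, mul_sum]
      exact sum_congr rfl fun i _ => by ring
    simp only [operator, hj, sum_mul]
    rw [sum_comm, he]
    refine sum_congr rfl fun r _ => ?_
    rw [← sum_theta_mul_bspline hab hn (Nat.lt_succ_iff.1 r.2) hu, mul_sum]
    exact sum_congr rfl fun j _ => by ring

theorem existsUnique_exactOn (hab : a < b) (hn : 1 ≤ n) {m : Fin (n + d) → ℕ}
    {τ : ∀ j, Fin (m j) → ℝ}
    (h : ∀ j, ∃! v, (systemMatrix d (τ j)).mulVec v = systemRhs a b n d j) :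
    ∃! w : ∀ j, Fin (m j) → ℝ, ExactOn a b d (operator a b n d τ w) := by
  choose w hw hw' using h
  refine ⟨w, (exactOn_operator_iff hab hn τ w).2 hw, fun w₁ h₁ => funext fun j => ?_⟩
  exact hw' j _ ((exactOn_operator_iff hab hn τ w₁).1 h₁ j)

theorem existsUnique_isDQI {m : Fin (n + d) → ℕ} {τ : ∀ j, Fin (m j) → ℝ}
    (hτ : ∀ j i, τ j i ∈ siteSet a b n d)
    (h : ∃! w : ∀ j, Fin (m j) → ℝ, ExactOn a b d (operator a b n d τ w)) :
    ∃! Q, IsDQI a b n d τ Q := by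
  obtain ⟨w, hw, hw'⟩ := h
  refine ⟨operator a b n d τ w, ⟨hτ, ⟨w, rfl⟩, hw⟩, ?_⟩
  rintro _ ⟨-, ⟨w₁, rfl⟩, h₁⟩
  rw [hw' w₁ h₁]

end Knots

/-! ### Solvability of the moment systems. -/

section System

variable {d m : ℕ} {τ : Fin m → ℝ}

theorem systemMatrix_submatrix (h : m ≤ d + 1) :
    (systemMatrix d τ).submatrix (Fin.castLE h) id = (Matrix.vandermonde τ).transpose := rfl

theorem det_systemMatrix_submatrix (h : m ≤ d + 1) :
    ((systemMatrix d τ).submatrix (Fin.castLE h) id).det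
      = ∏ i, ∏ k ∈ Ioi i, (τ k - τ i) := by
  rw [systemMatrix_submatrix, Matrix.det_transpose, Matrix.det_vandermonde]

theorem det_systemMatrix_submatrix_ne_zero (h : m ≤ d + 1) (hτ : Function.Injective τ) :
    ((systemMatrix d τ).submatrix (Fin.castLE h) id).det ≠ 0 := by
  rw [systemMatrix_submatrix, Matrix.det_transpose]
  exact Matrix.det_vandermonde_ne_zero_iff.2 hτ

theorem mulVec_systemMatrix_injective (h : m ≤ d + 1) (hτ : Function.Injective τ) :
    Function.Injective (systemMatrix d τ).mulVec := by
  intro v w hvw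
  refine Matrix.mulVec_injective_of_isUnit ((Matrix.isUnit_iff_isUnit_det _).2
    (det_systemMatrix_submatrix_ne_zero h hτ).isUnit) ?_
  ext r
  exact congrFun hvw (Fin.castLE h r)

theorem exists_mulVec_castLE (h : m ≤ d + 1) (hτ : Function.Injective τ)
    (y : Fin (d + 1) → ℝ) :
    ∃ v, ∀ r : Fin m, (systemMatrix d τ).mulVec v (Fin.castLE h r) = y (Fin.castLE h r) := by
  obtain ⟨v, hv⟩ := Matrix.mulVec_surjective_iff_isUnit.2 ((Matrix.isUnit_iff_isUnit_det _).2
    (det_systemMatrix_submatrix_ne_zero h hτ).isUnit) fun r => y (Fin.castLE h r)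
  exact ⟨v, fun r => congrFun hv r⟩

/-- The square system with distinct nodes. -/
theorem existsUnique_mulVec_of_card_eq (hm : m = d + 1) (hτ : Function.Injective τ)
    (y : Fin (d + 1) → ℝ) : ∃! v, (systemMatrix d τ).mulVec v = y := by
  subst hm
  obtain ⟨v, hv⟩ := exists_mulVec_castLE le_rfl hτ y
  exact ⟨v, funext hv, fun w hw =>
    mulVec_systemMatrix_injective le_rfl hτ (hw.trans (funext hv).symm)⟩

/-- A single node solves the system whose right-hand side consists of its powers. -/
theorem existsUnique_mulVec_of_card_eq_one (hm : m = 1) {c : ℝ} (hc : ∀ i, τ i = c)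
    {y : Fin (d + 1) → ℝ} (hy : ∀ r, y r = c ^ (r : ℕ)) :
    ∃! v, (systemMatrix d τ).mulVec v = y := by
  subst hm
  have hτ : Function.Injective τ := fun i j _ => Subsingleton.elim i j
  have h1 : (systemMatrix d τ).mulVec 1 = y := by
    ext r
    simp [systemMatrix, Matrix.mulVec, dotProduct, hc, hy]
  exact ⟨1, h1, fun w hw => mulVec_systemMatrix_injective (by omega) hτ (hw.trans h1.symm)⟩

/-- For odd `d`, the blossom of `∏ (X - t)` vanishes at the `d` zeros `t`. -/
theorem sum_coeff_mul_esymm_eq_zero (hd : Odd d) {s : Multiset ℝ} (hs : s.card = d) :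
    ∑ r ∈ range (d + 1), (s.map fun t => X - C t).prod.coeff r *
      (((d.choose r : ℕ) : ℝ)⁻¹ * s.esymm r) = 0 := by
  set S := ∑ r ∈ range (d + 1), (s.map fun t => X - C t).prod.coeff r *
      (((d.choose r : ℕ) : ℝ)⁻¹ * s.esymm r) with hS
  -- Under r ↦ d - r the two symmetric functions in a term change places, the binomial coefficient
  -- stays, and the sign flips because `d` is odd.
  have h : S = -S := by
    conv_lhs => rw [hS, ← sum_range_reflect]
    rw [hS, ← sum_neg_distrib]
    refine sum_congr rfl fun r hr => ?_
    have hr' : r ≤ d := Nat.lt_succ_iff.1 (mem_range.1 hr)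
    rw [show d + 1 - 1 - r = d - r by omega, Multiset.prod_X_sub_C_coeff _ (by omega),
      Multiset.prod_X_sub_C_coeff _ (by omega), hs, Nat.sub_sub_self hr', Nat.choose_symm hr']
    have hsign : (-1 : ℝ) ^ r = -(-1) ^ (d - r) := by
      have h1 : (-1 : ℝ) ^ (d - r) * (-1) ^ r = -1 := by
        rw [← pow_add, Nat.sub_add_cancel hr', hd.neg_one_pow]
      have h2 : (-1 : ℝ) ^ (d - r) * (-1) ^ (d - r) = 1 := by
        rw [← mul_pow]
        simp
      linear_combination (-1 : ℝ) ^ (d - r) * h1 - (-1 : ℝ) ^ r * h2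
    rw [hsign]
    ring
  linarith

/-- For odd `d`, the system with the `d` interior knots as nodes is solvable although it has one
more equation than unknowns. -/
theorem existsUnique_mulVec_of_odd (hd : Odd d) (hm : m = d) (hτ : Function.Injective τ)
    {y : Fin (d + 1) → ℝ} {z : ℕ → ℝ} (hz : ∀ i, τ i = z i)
    (hy : ∀ r : Fin (d + 1), y r = ((d.choose r : ℕ) : ℝ)⁻¹ * ((Multiset.range d).map z).esymm r) :
    ∃! v, (systemMatrix d τ).mulVec v = y := by
  subst hm
  obtain ⟨v, hv⟩ := exists_mulVec_castLE m.le_succ hτ y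
  suffices h : (systemMatrix m τ).mulVec v = y from
    ⟨v, h, fun w hw => mulVec_systemMatrix_injective m.le_succ hτ (hw.trans h.symm)⟩
  set s : Multiset ℝ := (Multiset.range m).map z with hs
  set p : ℝ[X] := (s.map fun t => X - C t).prod with hp
  have hcard : s.card = m := by simp [hs]
  have hroot : ∀ i, p.eval (τ i) = 0 := fun i => by
    rw [hp, eval_multiset_prod, Multiset.map_map]
    refine Multiset.prod_eq_zero (Multiset.mem_map.2 ⟨τ i, ?_, by simp⟩)
    rw [hz, hs]
    exact Multiset.mem_map_of_mem _ (Multiset.mem_range.2 i.2)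
  have hdeg : p.natDegree = m := by
    rw [hp, natDegree_multiset_prod_X_sub_C_eq_card, hcard]
  have hlead : p.coeff m = 1 := by
    rw [← hdeg]
    exact (monic_multiset_prod_of_monic _ _ fun t _ => monic_X_sub_C t).coeff_natDegree
  -- Both sides of the system are paired with the coefficients of `p`: the right side gives a
  -- vanishing blossom, the left side a combination of values of `p` at its zeros. As `p` is monic
  -- of degree `m`, the first `m` equations then force the last.
  have h1 : ∑ r : Fin (m + 1), p.coeff r * y r = 0 := by
    rw [← sum_coeff_mul_esymm_eq_zero hd hcard, ← Fin.sum_univ_eq_sum_range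
      (fun r => p.coeff r * (((m.choose r : ℕ) : ℝ)⁻¹ * s.esymm r))]
    exact sum_congr rfl fun r _ => by rw [hy]
  have h2 : ∑ r : Fin (m + 1), p.coeff r * (systemMatrix m τ).mulVec v r = 0 := by
    have : ∑ i, v i * p.eval (τ i) = 0 := by simp [hroot]
    rw [← this]
    simp only [eval_eq_sum_range, hdeg, Matrix.mulVec, dotProduct, mul_sum]
    rw [sum_comm]
    refine sum_congr rfl fun i _ => ?_
    rw [← Fin.sum_univ_eq_sum_range (fun r => v i * (p.coeff r * τ i ^ r))]
    exact sum_congr rfl fun r _ => by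
      rw [systemMatrix, Matrix.of_apply]
      ring
  rw [Fin.sum_univ_castSucc] at h1 h2
  have h3 : ∀ r : Fin m, (systemMatrix m τ).mulVec v r.castSucc = y r.castSucc := hv
  simp only [h3, Fin.val_last, hlead, one_mul] at h1 h2
  ext r
  induction r using Fin.lastCases with
  | last => linarith
  | cast r => exact h3 r

end System

/-! ### The standard nodes. -/

section Standard

variable {a b : ℝ} {n d : ℕ}

theorem theta_eq_pow {j : ℤ} {r : ℕ} (hr : r ≤ d) {c : ℝ}
    (hc : ∀ l : ℕ, l < d → knot a b n (j - d + l) = c) : theta a b n d j r = c ^ r := by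
  have h1 : ((Multiset.range d).map fun l : ℕ => knot a b n (j - d + l))
      = Multiset.replicate d c := by
    rw [Multiset.eq_replicate]
    refine ⟨by simp, fun y hy => ?_⟩
    obtain ⟨l, hl, rfl⟩ := Multiset.mem_map.1 hy
    exact hc l (Multiset.mem_range.1 hl)
  have h2 : (d.choose r : ℝ) ≠ 0 := by exact_mod_cast (Nat.choose_pos hr).ne'
  -- For constant knots `dualPoly` is (X + c)^d, whose coefficients give the symmetric functions of
  -- d equal arguments.
  have h3 := coeff_dualPoly (x := fun _ => c) hr 0
  rw [dualPoly, prod_const, card_range, coeff_X_add_C_pow, Nat.choose_symm hr,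
    Nat.sub_sub_self hr, Multiset.map_const', Multiset.card_range] at h3
  rw [theta, h1, ← h3, mul_comm, mul_assoc, mul_inv_cancel₀ h2, mul_one]

theorem site_lt (hab : a < b) (hn : 1 ≤ n) {i j : ℤ} (hij : i < j)
    (hi : (if Even d then 1 else 0) ≤ i) (hj : j ≤ if Even d then (n : ℤ) + 2 else n) :
    site a b n d i < site a b n d j := by
  unfold site
  split_ifs at * with h
  · have h1 := knot_monotone (n := n) hab (show i - 2 ≤ j - 2 by omega)
    have h2 := knot_monotone (n := n) hab (show i - 1 ≤ j - 1 by omega)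
    -- For i ≤ n the right knots of the two midpoints differ; the only other case is i = n + 1, j =
    -- n + 2, where the left ones do.
    by_cases hin : i ≤ n
    · have := knot_lt hab hn (show i - 1 < j - 1 by omega) (by omega) (by omega)
      linarith
    · have := knot_lt hab hn (show i - 2 < j - 2 by omega) (by omega) (by omega)
      linarith
  · exact knot_lt hab hn hij (by omega) (by omega)

theorem stdCard_le (j : ℤ) : stdCard n d j ≤ d + 1 := by
  unfold stdCard
  split_ifs <;> omega

theorem le_stdFirst (hn : 1 ≤ n) (hdn : d ≤ n) (j : Fin (n + d)) :
    (if Even d then 1 else 0) ≤ stdFirst n d (idx j) := by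
  unfold stdFirst idx
  split_ifs <;> omega

theorem stdFirst_add_le (hd : 1 ≤ d) (hdn : d ≤ n) (j : Fin (n + d))
    (i : Fin (stdCard n d (idx j))) :
    stdFirst n d (idx j) + (i : ℕ) ≤ if Even d then (n : ℤ) + 2 else n := by
  have hi := i.2
  have hj := j.2
  unfold stdCard at hi
  generalize (i : ℕ) = k at *
  simp only [← Nat.not_even_iff_odd] at hi
  unfold stdFirst
  unfold idx at *
  by_cases h : Even d
  · have : d ≠ 1 := by
      rintro rfl
      simp at h
    simp only [h, not_true_eq_false, false_and, if_false, if_true] at hi ⊢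
    split_ifs at hi ⊢ <;> omega
  · simp only [h, not_false_eq_true, true_and, if_false] at hi ⊢
    split_ifs at hi ⊢ <;> omega

theorem stdNodes_injective (hab : a < b) (hn : 1 ≤ n) (hd : 1 ≤ d) (hdn : d ≤ n)
    (j : Fin (n + d)) : Function.Injective (stdNodes a b n d j) := by
  refine StrictMono.injective fun i k hik => ?_
  refine site_lt hab hn (by simpa using hik) ?_ (stdFirst_add_le hd hdn j k)
  have := le_stdFirst hn hdn j
  omega

theorem stdNodes_mem (hn : 1 ≤ n) (hd : 1 ≤ d) (hdn : d ≤ n) (j : Fin (n + d))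
    (i : Fin (stdCard n d (idx j))) : stdNodes a b n d j i ∈ siteSet a b n d := by
  have h1 := le_stdFirst hn hdn j
  have h2 := stdFirst_add_le hd hdn j i
  unfold siteSet stdNodes
  by_cases h : Even d
  -- An even d ≥ 1 is at least 2, so the last distinct site t_{n+2} has an index at most n + d.
  · have : d ≠ 1 := by
      rintro rfl
      simp at h
    simp only [h, if_true] at h1 h2 ⊢
    exact ⟨_, ⟨by omega, by omega⟩, rfl⟩
  · simp only [h, if_false] at h1 h2 ⊢
    exact ⟨_, ⟨by omega, by omega⟩, rfl⟩

theorem site_stdFirst_one (hd : 1 ≤ d) (hn : 1 ≤ n) : site a b n d (stdFirst n d 1) = a := by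
  unfold site stdFirst
  by_cases h : Even d
  · simp only [h, if_true]
    rw [if_pos (by omega), knot_of_nonpos (by omega), knot_of_nonpos (by omega)]
    ring
  · simp only [h, if_false]
    rw [knot_of_nonpos]
    split_ifs <;> omega

theorem site_stdFirst_last (hd : 1 ≤ d) (hn : 1 ≤ n) :
    site a b n d (stdFirst n d (n + d)) = b := by
  unfold site stdFirst
  by_cases h : Even d
  · have : d ≠ 0 := by omega
    simp only [h, if_true]
    rw [if_neg (by omega), if_neg (by omega), if_neg (by omega), knot_of_ge hn (by omega),
      knot_of_ge hn (by omega)]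
    ring
  · simp only [h, if_false]
    rw [knot_of_ge hn]
    split_ifs <;> omega

theorem existsUnique_mulVec_stdNodes (hab : a < b) (hn : 1 ≤ n) (hd : 1 ≤ d) (hdn : d ≤ n)
    (j : Fin (n + d)) :
    ∃! v, (systemMatrix d (stdNodes a b n d j)).mulVec v = systemRhs a b n d j := by
  have hinj := stdNodes_injective hab hn hd hdn j
  by_cases h1 : idx j = 1 ∨ idx j = n + d
  · have hcard : stdCard n d (idx j) = 1 := if_pos h1
    have hi : ∀ i : Fin (stdCard n d (idx j)), ((i : ℕ) : ℤ) = 0 := fun i => by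
      have := i.2
      omega
    rcases h1 with h1 | h1
    · refine existsUnique_mulVec_of_card_eq_one hcard (c := a) (fun i => ?_) fun r => ?_
      · rw [stdNodes, hi, add_zero, h1, site_stdFirst_one hd hn]
      · exact theta_eq_pow (Nat.lt_succ_iff.1 r.2) fun l hl => knot_of_nonpos (by omega)
    · refine existsUnique_mulVec_of_card_eq_one hcard (c := b) (fun i => ?_) fun r => ?_
      · rw [stdNodes, hi, add_zero, h1, site_stdFirst_last hd hn]
      · exact theta_eq_pow (Nat.lt_succ_iff.1 r.2) fun l hl => knot_of_ge hn (by omega)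
  · by_cases h2 : Odd d ∧ (d : ℤ) ≤ idx j ∧ idx j ≤ n + 1
    · have hcard : stdCard n d (idx j) = d := by rw [stdCard, if_neg h1, if_pos h2]
      -- Here `stdFirst` is j - d, so the nodes are the very knots that enter `theta`, in the same
      -- order.
      refine existsUnique_mulVec_of_odd h2.1 hcard hinj
        (z := fun l : ℕ => knot a b n (idx j - d + l)) (fun i => ?_) fun r => rfl
      have he : ¬ Even d := Nat.not_even_iff_odd.2 h2.1
      rw [stdNodes, site, if_neg he, stdFirst, if_neg he, if_neg (by omega), if_pos h2.2.2]
    · exact existsUnique_mulVec_of_card_eq (by rw [stdCard, if_neg h1, if_neg h2]) hinj _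

end Standard

end DQI

theorem mainTheorem5 (a b : ℝ) (hab : a < b) (n d : ℕ) (hn : 1 ≤ n) (hd : 1 ≤ d) :
    -- exactness is equivalent to one linear system for each functional
    (∀ (m : Fin (n + d) → ℕ) (τ w : ∀ j, Fin (m j) → ℝ),
      DQI.ExactOn a b d (DQI.operator a b n d τ w) ↔
        ∀ j, (DQI.systemMatrix d (τ j)).mulVec (w j) = DQI.systemRhs a b n d j) ∧
    -- arbitrary prescribed sets of `d + 1` distinct nodes
    (∀ τ : Fin (n + d) → Fin (d + 1) → ℝ,
      (∀ j i, τ j i ∈ DQI.siteSet a b n d) → (∀ j, Function.Injective (τ j)) →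
        (∀ j, (DQI.systemMatrix d (τ j)).det
            = ∏ i : Fin (d + 1), ∏ k ∈ Finset.Ioi i, (τ j k - τ j i) ∧
          (DQI.systemMatrix d (τ j)).det ≠ 0) ∧
        (∀ j, ∃! v, (DQI.systemMatrix d (τ j)).mulVec v = DQI.systemRhs a b n d j) ∧
        (∃! w : Fin (n + d) → Fin (d + 1) → ℝ,
          DQI.ExactOn a b d (DQI.operator a b n d τ w)) ∧
        (∃! Q, DQI.IsDQI a b n d τ Q)) ∧
    -- the standard choice of nodes
    (d ≤ n →
      (∀ j, Function.Injective (DQI.stdNodes a b n d j)) ∧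
      (∀ j, ∃ h : DQI.stdCard n d (DQI.idx j) ≤ d + 1,
        ((DQI.systemMatrix d (DQI.stdNodes a b n d j)).submatrix (Fin.castLE h) id).det
            = ∏ i, ∏ k ∈ Finset.Ioi i,
              (DQI.stdNodes a b n d j k - DQI.stdNodes a b n d j i) ∧
          ((DQI.systemMatrix d (DQI.stdNodes a b n d j)).submatrix (Fin.castLE h) id).det ≠ 0) ∧
      (∀ j, ∃! v, (DQI.systemMatrix d (DQI.stdNodes a b n d j)).mulVec v
          = DQI.systemRhs a b n d j) ∧
      (∃! w : ∀ j : Fin (n + d), Fin (DQI.stdCard n d (DQI.idx j)) → ℝ,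
        DQI.ExactOn a b d (DQI.operator a b n d (DQI.stdNodes a b n d) w)) ∧
      (∃! Q, DQI.IsDQI a b n d (DQI.stdNodes a b n d) Q)) := by
  refine ⟨fun m τ w => DQI.exactOn_operator_iff hab hn τ w, fun τ hτ hinj => ?_, fun hdn => ?_⟩
  · have hsys : ∀ j, ∃! v, (DQI.systemMatrix d (τ j)).mulVec v = DQI.systemRhs a b n d j :=
      fun j => DQI.existsUnique_mulVec_of_card_eq rfl (hinj j) _
    have hex := DQI.existsUnique_exactOn hab hn hsys
    exact ⟨fun j => ⟨DQI.det_systemMatrix_submatrix le_rfl,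
      DQI.det_systemMatrix_submatrix_ne_zero le_rfl (hinj j)⟩, hsys, hex,
      DQI.existsUnique_isDQI hτ hex⟩
  · have hinj := DQI.stdNodes_injective hab hn hd hdn
    have hsys := DQI.existsUnique_mulVec_stdNodes hab hn hd hdn
    have hex := DQI.existsUnique_exactOn hab hn hsys
    exact ⟨hinj, fun j => ⟨DQI.stdCard_le _, DQI.det_systemMatrix_submatrix _,
      DQI.det_systemMatrix_submatrix_ne_zero _ (hinj j)⟩, hsys, hex,
      DQI.existsUnique_isDQI (DQI.stdNodes_mem hn hd hdn) hex⟩
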